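/- Let $q \ge 2$, $t \ge 0$, $M \ge 1$ and $N \ge 0$ be integers with $N \ge (t+1)^2 (M-1)$. Then there is a $q$-ary quantum code on $N$ qudits with $M$ logical codewords, that is, an $M$-dimensional subspace $C$ of $(\mathbb{C}^q)^{\otimes N}$, that is permutation-invariant (every $|\psi\rangle \in C$ is fixed by every permutation of the $N$ tensor factors) and corrects $t$ deletions: for every $s \le \min(t,N)$ there is a quantum channel (completely positive trace-preserving map) $\mathcal{R}_s$ from $N-s$ qudits to $N$ qudits such that $$\mathcal{R}_s\big(\mathrm{Tr}_S\,|\psi\rangle\langle\psi|\big) = |\psi\rangle\langle\psi|$$ for every $|\psi\rangle \in C$ and every set $S$ of $s$ of the $N$ positions. Here $\mathrm{Tr}_S$ traces out the qudits at the positions in $S$ and keeps the remaining $N-s$ qudits in their order. The channel $\mathcal{R}_s$ does not depend on $S$. -/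

import Mathlib

/-- The Hilbert space `(ℂ^q)^{⊗N}` of `N` qudits of dimension `q`, with the computational basis
indexed by the strings `Fin N → Fin q`. -/
abbrev QuditSpace (q N : ℕ) : Type := EuclideanSpace ℂ (Fin N → Fin q)

/-- Operators on `N` qudits, as matrices in the computational basis. -/
abbrev QuditOp (q N : ℕ) : Type := Matrix (Fin N → Fin q) (Fin N → Fin q) ℂ

/-- The operator `|ψ⟩⟨ψ|`. -/
noncomputable def pureState {q N : ℕ} (ψ : QuditSpace q N) : QuditOp q N :=
  Matrix.of fun x y => ψ x * star (ψ y)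

/-- A quantum channel (completely positive trace-preserving map) from `n` to `N` qudits,
in operator-sum (Kraus) form. -/
def IsQuantumChannel {q n N : ℕ} (Φ : QuditOp q n → QuditOp q N) : Prop :=
  ∃ (ι : Type) (_ : Fintype ι) (K : ι → Matrix (Fin N → Fin q) (Fin n → Fin q) ℂ),
    ∑ i, (K i).conjTranspose * K i = 1 ∧
    ∀ X, Φ X = ∑ i, K i * X * (K i).conjTranspose

/-- The deletion map: `e` lists, in increasing order, the positions of the `n` surviving qudits.
All other qudits are traced out, and the survivors are relabelled `0, …, n - 1` in order, so that
the output carries no record of which positions were lost. -/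
def deletion {q n N : ℕ} (e : Fin n ↪o Fin N) (ρ : QuditOp q N) : QuditOp q n :=
  Matrix.of fun x y => ∑ z : Fin N → Fin q, ∑ w : Fin N → Fin q,
    if (∀ k, z (e k) = x k) ∧ (∀ k, w (e k) = y k) ∧ (∀ i, (∀ k, e k ≠ i) → z i = w i)
    then ρ z w else 0

/-- The code `C` corrects `t` deletions: whenever `n ≤ N` qudits with `N - n ≤ t` are received,
a single channel, which does not depend on the unknown positions of the deleted qudits, restores
every code state. (The vectors `ψ` need not be normalised, as both sides scale by `|c|²`.) -/
def CorrectsDeletions {q N : ℕ} (t : ℕ) (C : Submodule ℂ (QuditSpace q N)) : Prop :=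
  ∀ n : ℕ, n ≤ N → N ≤ n + t →
    ∃ R : QuditOp q n → QuditOp q N, IsQuantumChannel R ∧
      ∀ e : Fin n ↪o Fin N, ∀ ψ ∈ C, R (deletion e (pureState ψ)) = pureState ψ

/-- Every state of the code is unchanged by every permutation of the `N` qudits. -/
def IsPermutationInvariant {q N : ℕ} (C : Submodule ℂ (QuditSpace q N)) : Prop :=
  ∀ ψ ∈ C, ∀ (σ : Equiv.Perm (Fin N)) (x : Fin N → Fin q), ψ (x ∘ σ) = ψ x

/-! The codewords are symmetric superpositions of binary strings: codeword `j` gives each string of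
weight `w` the amplitude `√(μ j w / N.choose w)`. By symmetry, deleting `s` qudits at any positions
leaves a mixture over the number `r ≤ s` of lost ones, with error operators `A n r`. Recovery is
possible if these satisfy the Knill–Laflamme conditions `(A n r)ᴴ * A n r' = δ_{r r'} γ • 1`.
Distinct `r`, `r'` are orthogonal because all weights used are multiples of `t + 1`; distinct
codewords stay orthogonal because their supports are disjoint; and the norms agree because each is
the `μ j`-mean of a polynomial of degree at most `s ≤ t` in `w`
(`exists_polynomial_sum_choose_div`).

It remains to find `M = m + 1` disjointly supported distributions with equal moments up to order
`t`. This is Tverberg's theorem for `(t + 1) m + 1` points of the moment curve, obtained from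
colourful Carathéodory by Sarkaria's tensor trick. Stretching `0, …, (t + 1) m` by `t + 1` gives the
bound `(t + 1)² m ≤ N`. -/

/-! ### Convex geometry: colourful Carathéodory and Tverberg -/

open scoped InnerProductSpace in
theorem norm_sq_le_inner_of_forall_mem_norm_le {E : Type*} [NormedAddCommGroup E]
    [InnerProductSpace ℝ E] {s : Set E} (hs : Convex ℝ s) {x : E} (hx : x ∈ s)
    (hmin : ∀ y ∈ s, ‖x‖ ≤ ‖y‖) {y : E} (hy : y ∈ s) : ‖x‖ ^ 2 ≤ ⟪x, y⟫_ℝ := by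
  have : Nonempty s := ⟨⟨x, hx⟩⟩
  have h := (norm_eq_iInf_iff_real_inner_le_zero hs (u := (0 : E)) hx).1 (by
    refine le_antisymm (le_ciInf fun w => ?_)
      (ciInf_le ⟨0, by rintro _ ⟨w, rfl⟩; exact norm_nonneg _⟩ (⟨x, hx⟩ : s))
    simpa using hmin w w.2) y hy
  simp only [zero_sub, inner_neg_left, inner_sub_right, real_inner_self_eq_norm_sq] at h
  linarith

open scoped InnerProductSpace in
/-- The colourful Carathéodory theorem. -/
theorem exists_zero_mem_convexHull_colorful {E ι κ : Type*} [NormedAddCommGroup E]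
    [InnerProductSpace ℝ E] [FiniteDimensional ℝ E] [Fintype ι] [Finite κ]
    (hcard : Module.finrank ℝ E < Fintype.card ι) (p : ι → κ → E)
    (h : ∀ i, (0 : E) ∈ convexHull ℝ (Set.range (p i))) :
    ∃ c : ι → κ, (0 : E) ∈ convexHull ℝ (Set.range fun i => p i (c i)) := by
  classical
  have hι : Nonempty ι := Fintype.card_pos_iff.1 (by omega)
  have hκ : Nonempty κ := by
    obtain ⟨i⟩ := hι
    have := convexHull_nonempty_iff.1 ⟨_, h i⟩
    exact Set.range_nonempty_iff_nonempty.1 this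
  let H : (ι → κ) → Set E := fun c => convexHull ℝ (Set.range fun i => p i (c i))
  have hH : ∀ c, Convex ℝ (H c) := fun c => convex_convexHull _ _
  have hcomp : IsCompact (⋃ c, H c) := isCompact_iUnion fun c =>
    (Set.finite_range fun i => p i (c i)).isCompact_convexHull ℝ
  have hne : (⋃ c, H c).Nonempty := by
    obtain ⟨i⟩ := hι
    obtain ⟨k⟩ := hκ
    exact ⟨p i k, Set.mem_iUnion.2 ⟨fun _ => k, subset_convexHull _ _ ⟨i, rfl⟩⟩⟩
  -- Bárány's argument: if the point `x` nearest to the origin in all colourful hulls is nonzero,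
  -- one colour can be swapped to get nearer.
  obtain ⟨x, hxU, hxmin⟩ := hcomp.exists_isMinOn hne continuous_norm.continuousOn
  have hmin : ∀ c, ∀ y ∈ H c, ‖x‖ ≤ ‖y‖ := fun c y hy => hxmin (Set.mem_iUnion.2 ⟨c, hy⟩)
  obtain ⟨c, hxc⟩ := Set.mem_iUnion.1 hxU
  by_cases hx0 : x = 0
  · exact ⟨c, hx0 ▸ hxc⟩
  exfalso
  have hxpos : 0 < ‖x‖ ^ 2 := by positivity
  obtain ⟨τ, _, z, w, hzr, hzind, hwpos, hwsum, hwz⟩ := eq_pos_convex_span_of_mem_convexHull hxc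
  have hge : ∀ i, ‖x‖ ^ 2 ≤ ⟪x, z i⟫_ℝ := fun i =>
    norm_sq_le_inner_of_forall_mem_norm_le (hH c) hxc (hmin c)
      (subset_convexHull _ _ (hzr ⟨i, rfl⟩))
  have hsum : ∑ i, w i * (⟪x, z i⟫_ℝ - ‖x‖ ^ 2) = 0 := by
    have : ∑ i, w i * ⟪x, z i⟫_ℝ = ‖x‖ ^ 2 := by
      rw [← real_inner_self_eq_norm_sq]
      calc ∑ i, w i * ⟪x, z i⟫_ℝ = ⟪x, ∑ i, w i • z i⟫_ℝ := by
            simp only [inner_sum, real_inner_smul_right]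
        _ = ⟪x, x⟫_ℝ := by rw [hwz]
    simp only [mul_sub, Finset.sum_sub_distrib, this, ← Finset.sum_mul, hwsum]
    ring
  have heq : ∀ i, ⟪x, z i⟫_ℝ = ‖x‖ ^ 2 := fun i => by
    have := (Finset.sum_eq_zero_iff_of_nonneg fun i _ =>
      mul_nonneg (hwpos i).le (sub_nonneg.2 (hge i))).1 hsum i (Finset.mem_univ i)
    rcases mul_eq_zero.1 this with h1 | h1
    · exact absurd h1 (hwpos i).ne'
    · linarith
  -- The affinely independent `z i` lie on a hyperplane missing the origin, so they are linearly
  -- independent. Hence fewer than `card ι` of them occur and some colour is unused.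
  have hlin : LinearIndependent ℝ z := by
    rw [Fintype.linearIndependent_iff]
    intro a ha i
    have h0 : ∑ i, a i = 0 := by
      have h1 : ⟪x, ∑ i, a i • z i⟫_ℝ = 0 := by rw [ha, inner_zero_right]
      simp only [inner_sum, real_inner_smul_right, heq, ← Finset.sum_mul] at h1
      exact (mul_eq_zero.1 h1).resolve_right hxpos.ne'
    exact affineIndependent_iff.1 hzind Finset.univ a h0 ha i (Finset.mem_univ i)
  have hcardτ : Fintype.card τ < Fintype.card ι := hlin.fintype_card_le_finrank.trans_lt hcard
  choose k hk using fun i => hzr ⟨i, rfl⟩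
  obtain ⟨k₀, hk₀⟩ : ∃ k₀, ∀ i, k i ≠ k₀ := by
    by_contra! hcon
    exact absurd (Fintype.card_le_of_surjective k hcon) (by omega)
  obtain ⟨j, hj⟩ : ∃ j, ⟪x, p k₀ j⟫_ℝ ≤ 0 := by
    by_contra! hcon
    have hconv : Convex ℝ {y : E | 0 < ⟪x, y⟫_ℝ} :=
      convex_halfSpace_gt (innerSL ℝ x).isBoundedLinearMap.toIsLinearMap 0
    have := convexHull_min (by rintro _ ⟨j, rfl⟩; exact hcon j) hconv (h k₀)
    simp at this
  have hx' : x ∈ H (Function.update c k₀ j) := by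
    rw [← hwz]
    refine (hH _).sum_mem (fun i _ => (hwpos i).le) hwsum fun i _ =>
      subset_convexHull _ _ ⟨k i, ?_⟩
    simpa [Function.update_of_ne (hk₀ i)] using hk i
  have := norm_sq_le_inner_of_forall_mem_norm_le (hH _) hx' (hmin _)
    (subset_convexHull _ _ ⟨k₀, rfl⟩)
  simp only [Function.update_self] at this
  linarith

/-- Tverberg's theorem, in homogeneous form: more than `(d + 1) r` vectors with `d + 1` coordinates
can be coloured with `r + 1` colours and given weights of total mass one
such that all colour classes have the same weighted sum. -/
theorem exists_coloring_weighted_sum_eq (δ ρ ι : Type*) [Fintype δ] [Fintype ρ] [DecidableEq ρ]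
    [Fintype ι] (hcard : Fintype.card δ * Fintype.card ρ < Fintype.card ι) (y : ι → δ → ℝ) :
    ∃ (c : ι → Option ρ) (w : ι → ℝ), (∀ i, 0 ≤ w i) ∧ ∑ i, w i = 1 ∧
      ∀ a b d, ∑ i, (if c i = a then w i * y i d else 0) =
        ∑ i, if c i = b then w i * y i d else 0 := by
  -- Sarkaria's trick: the vectors `v o` sum to zero, so `0` is the barycentre of the tensors `y i ⊗
  -- v o` for each `i`. Coordinate `(d, r)` of a colourful relation compares class `some r` with
  -- class `none`.
  let v : Option ρ → ρ → ℝ := fun o j => o.elim (-1) fun k => if k = j then 1 else 0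
  have hv : ∀ j, ∑ o, v o j = 0 := fun j => by simp [v, Fintype.sum_option]
  let p : ι → Option ρ → EuclideanSpace ℝ (δ × ρ) :=
    fun i o => WithLp.toLp 2 fun dj => y i dj.1 * v o dj.2
  obtain ⟨c, hc⟩ := exists_zero_mem_convexHull_colorful (by simpa using hcard) p (fun i => by
    have hm := (convex_convexHull ℝ (Set.range (p i))).sum_mem (t := Finset.univ)
      (w := fun _ : Option ρ => ((Fintype.card (Option ρ) : ℝ))⁻¹) (z := p i)
      (fun _ _ => by positivity) (by simp [-Fintype.card_option])
      (fun o _ => subset_convexHull _ _ ⟨o, rfl⟩)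
    have h0 : ∑ o, ((Fintype.card (Option ρ) : ℝ))⁻¹ • p i o = 0 := by
      rw [← Finset.smul_sum]
      have : ∑ o, p i o = 0 := by
        ext dj
        simp [p, ← Finset.mul_sum, -Fintype.sum_option, hv]
      rw [this, smul_zero]
    rwa [h0] at hm)
  rw [convexHull_range_eq_exists_affineCombination] at hc
  obtain ⟨s, w, hw0, hw1, hwc⟩ := hc
  have : DecidablePred (· ∈ s) := Classical.decPred _
  rw [Finset.affineCombination_eq_linear_combination _ _ _ hw1] at hwc
  have key : ∀ r d, ∑ i ∈ s, (if c i = some r then w i * y i d else 0) =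
      ∑ i ∈ s, if c i = none then w i * y i d else 0 := by
    intro r d
    have h1 := congrArg (fun x : EuclideanSpace ℝ (δ × ρ) => x (d, r)) hwc
    simp only [p, WithLp.ofLp_sum, WithLp.ofLp_smul, Finset.sum_apply, Pi.smul_apply, smul_eq_mul,
      WithLp.ofLp_zero, Pi.zero_apply] at h1
    rw [← sub_eq_zero, ← Finset.sum_sub_distrib]
    refine (Finset.sum_congr rfl fun i _ => ?_).trans h1
    rcases c i with _ | k
    · simp [v]
    · by_cases hk : k = r <;> simp [v, hk]
  have key' : ∀ a d, ∑ i ∈ s, (if c i = a then w i * y i d else 0) =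
      ∑ i ∈ s, if c i = none then w i * y i d else 0 := by
    rintro (_ | r) d
    · rfl
    · exact key r d
  have hext : ∀ a d, ∑ i, (if c i = a then (if i ∈ s then w i else 0) * y i d else 0) =
      ∑ i ∈ s, if c i = a then w i * y i d else 0 := by
    intro a d
    rw [← Finset.sum_subset (Finset.subset_univ s) fun i _ hi => by simp [hi]]
    exact Finset.sum_congr rfl fun i hi => by simp [hi]
  refine ⟨c, fun i => if i ∈ s then w i else 0, fun i => ?_, by simpa using hw1, fun a b d => ?_⟩
  · dsimp only
    split_ifs with hi
    exacts [hw0 i hi, le_rfl]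
  · rw [hext, hext, key' a, key' b]

/-! ### Tverberg on the moment curve -/

/-- `(t + 1) m + 1` consecutive integers split into `m + 1` classes carrying weights
which agree on all polynomials of degree at most `t`. -/
theorem exists_coloring_moments_eq (t m : ℕ) :
    ∃ (c : Fin ((t + 1) * m + 1) → Fin (m + 1)) (w : Fin ((t + 1) * m + 1) → ℝ),
      (∀ i, 0 ≤ w i) ∧ ∑ i, w i = 1 ∧
      ∀ (P : Polynomial ℝ), P.natDegree ≤ t → ∀ a b,
        ∑ i, (if c i = a then w i * P.eval (i : ℝ) else 0) =
          ∑ i, if c i = b then w i * P.eval (i : ℝ) else 0 := by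
  obtain ⟨c, w, hw0, hw1, h⟩ := exists_coloring_weighted_sum_eq (Fin (t + 1)) (Fin m)
    (Fin ((t + 1) * m + 1)) (by simp) fun i d => (i : ℝ) ^ (d : ℕ)
  let φ := (finSuccEquiv m).symm
  refine ⟨fun i => φ (c i), w, hw0, hw1, fun P hP a b => ?_⟩
  have hrw : ∀ a, ∑ i, (if φ (c i) = a then w i * P.eval (i : ℝ) else 0) =
      ∑ d : Fin (t + 1), P.coeff d *
        ∑ i, if c i = φ.symm a then w i * (i : ℝ) ^ (d : ℕ) else 0 := by
    intro a
    simp only [Finset.mul_sum]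
    rw [Finset.sum_comm]
    refine Finset.sum_congr rfl fun i _ => ?_
    simp only [← Equiv.eq_symm_apply]
    split_ifs
    · rw [Polynomial.eval_eq_sum_range' (Nat.lt_succ_of_le hP), ← Fin.sum_univ_eq_sum_range
        (fun d => P.coeff d * (i : ℝ) ^ d), Finset.mul_sum]
      exact Finset.sum_congr rfl fun d _ => by ring
    · simp
  rw [hrw, hrw]
  exact Finset.sum_congr rfl fun d _ => by rw [h]

/-! ### Recovery from the Knill–Laflamme conditions -/

open scoped Matrix ComplexOrder in
/-- Errors taking an isometric encoding `B` to isometries up to scalars, with pairwise orthogonal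
ranges, can be reverted by a quantum channel. -/
theorem exists_recovery_channel {q n N : ℕ} {J ι : Type} [Fintype J] [DecidableEq J]
    [Fintype ι] [DecidableEq ι] (x₀ : Fin N → Fin q)
    (B : Matrix (Fin N → Fin q) J ℂ) (hB : Bᴴ * B = 1)
    (F : ι → Matrix (Fin n → Fin q) J ℂ) (g : ι → ℝ) (hg : ∀ r, 0 ≤ g r)
    (hF : ∀ r r', (F r)ᴴ * F r' = if r = r' then (g r : ℂ) • 1 else 0) :
    ∃ R : QuditOp q n → QuditOp q N, IsQuantumChannel R ∧
      (∀ (w : ι → ℂ) (Z : Matrix J J ℂ),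
        R (∑ r, w r • (F r * Z * (F r)ᴴ)) = (∑ r, w r * g r) • (B * Z * Bᴴ)) := by
  have hF0 : ∀ r, g r = 0 → F r = 0 := fun r h => by
    rw [← Matrix.conjTranspose_mul_self_eq_zero, hF, if_pos rfl, h]
    simp
  -- The convention `0⁻¹ = 0` is harmless, as `g r = 0` forces `F r = 0`.
  have hinv : ∀ r, ((g r)⁻¹ : ℂ) • ((g r : ℂ) • F r) = F r := fun r => by
    by_cases h : g r = 0
    · simp [hF0 r h]
    · rw [smul_smul, inv_mul_cancel₀ (by exact_mod_cast h), one_smul]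
  -- `Q` projects onto the sum of the error ranges.
  set Q : QuditOp q n := ∑ r, ((g r)⁻¹ : ℂ) • (F r * (F r)ᴴ) with hQ
  have hQF : ∀ r, Q * F r = F r := fun r => by
    rw [hQ, Matrix.sum_mul, Finset.sum_eq_single r]
    · rw [Matrix.smul_mul, Matrix.mul_assoc, hF, if_pos rfl, Matrix.mul_smul, Matrix.mul_one, hinv]
    · intro r' _ h
      rw [Matrix.smul_mul, Matrix.mul_assoc, hF, if_neg h, Matrix.mul_zero, smul_zero]
    · simp
  have hQQ : Q * Q = Q := by
    calc Q * Q = ∑ r, ((g r)⁻¹ : ℂ) • (Q * F r * (F r)ᴴ) := by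
          nth_rw 2 [hQ]
          simp only [Matrix.mul_sum, Matrix.mul_smul, ← Matrix.mul_assoc]
      _ = Q := by simp only [hQF]; exact hQ.symm
  have hQH : Qᴴ = Q := by
    simp [hQ, Matrix.conjTranspose_sum, Matrix.conjTranspose_smul, Matrix.conjTranspose_mul]
  -- The complement of the error ranges is sent to the fixed basis state `x₀`, only to make the map
  -- trace preserving.
  let E : (Fin n → Fin q) → Matrix (Fin N → Fin q) (Fin n → Fin q) ℂ :=
    fun b => Matrix.single x₀ b 1
  have hE : ∑ b, (E b)ᴴ * E b = 1 := by
    simp only [E, Matrix.conjTranspose_single, Matrix.single_mul_single_same, star_one, mul_one]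
    exact Matrix.sum_single_one
  let K : ι ⊕ (Fin n → Fin q) → Matrix (Fin N → Fin q) (Fin n → Fin q) ℂ :=
    Sum.elim (fun r => ((Real.sqrt (g r))⁻¹ : ℂ) • (B * (F r)ᴴ)) (fun b => E b * (1 - Q))
  have hs : ∀ r, ((Real.sqrt (g r))⁻¹ : ℂ) * ((Real.sqrt (g r))⁻¹ : ℂ) = ((g r)⁻¹ : ℂ) :=
    fun r => by rw [← mul_inv, ← Complex.ofReal_mul, Real.mul_self_sqrt (hg r)]
  have hst : ∀ r, star ((Real.sqrt (g r))⁻¹ : ℂ) = ((Real.sqrt (g r))⁻¹ : ℂ) := fun r => by simp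
  refine ⟨fun X => ∑ i, K i * X * (K i)ᴴ, ⟨_, inferInstance, K, ?_, fun _ => rfl⟩, ?_⟩
  · rw [Fintype.sum_sum_type]
    have h1 : ∀ r, (K (Sum.inl r))ᴴ * K (Sum.inl r) = ((g r)⁻¹ : ℂ) • (F r * (F r)ᴴ) := fun r => by
      simp only [K, Sum.elim_inl, Matrix.conjTranspose_smul, Matrix.conjTranspose_mul,
        Matrix.conjTranspose_conjTranspose,
        Matrix.smul_mul, Matrix.mul_smul, smul_smul, hst, hs]
      rw [Matrix.mul_assoc (F r), ← Matrix.mul_assoc Bᴴ, hB, Matrix.one_mul]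
    have h2 : ∀ b, (K (Sum.inr b))ᴴ * K (Sum.inr b) = (1 - Q) * ((E b)ᴴ * E b) * (1 - Q) :=
      fun b => by
        simp only [K, Sum.elim_inr, Matrix.conjTranspose_mul, Matrix.conjTranspose_sub, hQH,
          Matrix.conjTranspose_one,
          Matrix.mul_assoc]
    simp only [h1, h2]
    rw [← hQ, ← Matrix.sum_mul, ← Matrix.mul_sum, hE]
    simp only [Matrix.mul_one, Matrix.mul_sub, Matrix.sub_mul, Matrix.one_mul, hQQ]
    abel
  · intro w Z
    have h1 : ∀ r, (K (Sum.inl r)) * (∑ r', w r' • (F r' * Z * (F r')ᴴ)) * (K (Sum.inl r))ᴴ =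
        (w r * g r) • (B * Z * Bᴴ) := by
      intro r
      rw [Matrix.mul_sum, Matrix.sum_mul, Finset.sum_eq_single r]
      · have : B * (F r)ᴴ * (F r * Z * (F r)ᴴ) * (F r * Bᴴ) =
            B * ((F r)ᴴ * F r) * Z * ((F r)ᴴ * F r) * Bᴴ := by simp only [Matrix.mul_assoc]
        simp only [K, Sum.elim_inl, Matrix.conjTranspose_smul, Matrix.conjTranspose_mul,
          Matrix.conjTranspose_conjTranspose, Matrix.smul_mul, Matrix.mul_smul, smul_smul,
          this, hF, if_true,
          Matrix.mul_one]
        have hsg : ((Real.sqrt (g r))⁻¹ : ℂ) * ((Real.sqrt (g r))⁻¹ : ℂ) * g r * g r = g r := by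
          rw [hs]
          by_cases h : (g r : ℂ) = 0
          · simp [h]
          · rw [inv_mul_cancel₀ h, one_mul]
        congr 1
        rw [hst]
        linear_combination w r * hsg
      · intro r' _ h
        have : B * (F r)ᴴ * (F r' * Z * (F r')ᴴ) =
            B * ((F r)ᴴ * F r') * Z * (F r')ᴴ := by simp only [Matrix.mul_assoc]
        simp [K, this, hF, Ne.symm h]
      · simp
    have h2 : ∀ b, (K (Sum.inr b)) * (∑ r', w r' • (F r' * Z * (F r')ᴴ)) = 0 := by
      intro b
      rw [Matrix.mul_sum]
      refine Finset.sum_eq_zero fun r _ => ?_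
      have : (1 - Q) * F r = 0 := by rw [Matrix.sub_mul, Matrix.one_mul, hQF, sub_self]
      simp only [K, Sum.elim_inr, Matrix.mul_smul, Matrix.mul_assoc]
      rw [← Matrix.mul_assoc (1 - Q), this]
      simp
    simp only [Fintype.sum_sum_type, h1, h2, Matrix.zero_mul, Finset.sum_const_zero, add_zero,
      Finset.sum_smul]

/-! ### Symmetric binary vectors and deletions -/

/-- The function on strings which vanishes unless all letters are `0` or `1`,
and whose value then depends on the number of ones only. -/
noncomputable def weightVec {q : ℕ} {ι : Type*} [Fintype ι] (f : ℕ → ℂ) (z : ι → Fin q) : ℂ :=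
  if ∀ i, (z i : ℕ) ≤ 1 then f (∑ i, (z i : ℕ)) else 0

theorem weightVec_comp_equiv {q : ℕ} {ι κ : Type*} [Fintype ι] [Fintype κ] (f : ℕ → ℂ)
    (z : ι → Fin q) (σ : κ ≃ ι) : weightVec f (z ∘ σ) = weightVec f z := by
  have h1 : (∀ i, ((z ∘ σ) i : ℕ) ≤ 1) ↔ ∀ i, (z i : ℕ) ≤ 1 :=
    σ.forall_congr_left (p := fun i => ((z ∘ σ) i : ℕ) ≤ 1) |>.trans (by simp)
  have h2 : ∑ i, ((z ∘ σ) i : ℕ) = ∑ i, (z i : ℕ) := Equiv.sum_comp σ fun i => (z i : ℕ)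
  simp only [weightVec, h1, h2]

/-- With `a` the lost letters, the survivors see only the number `r` of ones in `a`. -/
theorem weightVec_sumElim {q : ℕ} {ι κ : Type*} [Fintype ι] [Fintype κ] (f : ℕ → ℂ)
    (x : ι → Fin q) (a : κ → Fin q) : weightVec f (Sum.elim x a) =
      weightVec (fun r => weightVec (fun m => f (m + r)) x) a := by
  simp only [weightVec, Sum.forall, Sum.elim_inl, Sum.elim_inr, Fintype.sum_sum_type]
  split_ifs <;> tauto

theorem star_weightVec_mul {q : ℕ} {ι : Type*} [Fintype ι] (f f' : ℕ → ℂ) (z : ι → Fin q) :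
    star (weightVec f z) * weightVec f' z = weightVec (fun m => star (f m) * f' m) z := by
  simp only [weightVec]
  split_ifs <;> simp

theorem weightVec_mul_star {q : ℕ} {ι : Type*} [Fintype ι] (f f' : ℕ → ℂ) (z : ι → Fin q) :
    weightVec f z * star (weightVec f' z) = weightVec (fun m => f m * star (f' m)) z := by
  simp only [weightVec]
  split_ifs <;> simp

theorem sum_weightVec {q : ℕ} (hq : 2 ≤ q) {ι : Type*} [Fintype ι] [DecidableEq ι] (f : ℕ → ℂ) :
    ∑ z : ι → Fin q, weightVec f z =
      ∑ m ∈ Finset.range (Fintype.card ι + 1), ((Fintype.card ι).choose m : ℂ) * f m := by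
  have h := Finset.sum_powerset_apply_card f (x := (Finset.univ : Finset ι))
  simp only [nsmul_eq_mul, Finset.card_univ, Finset.powerset_univ] at h
  rw [← h]
  symm
  let φ : Finset ι → ι → Fin q := fun s i => ⟨if i ∈ s then 1 else 0, by split_ifs <;> omega⟩
  refine Finset.sum_of_injOn φ ?_ (by simp) ?_ ?_
  · intro s _ s' _ h
    ext i
    have := congrArg Fin.val (congrFun h i)
    simp only [φ] at this
    split_ifs at this <;> tauto
  · intro z _ hz
    rw [weightVec, if_neg]
    intro hle
    refine hz ⟨Finset.univ.filter fun i => (z i : ℕ) = 1, by simp, ?_⟩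
    ext i
    have := hle i
    simp only [φ, Finset.mem_filter, Finset.mem_univ, true_and]
    split_ifs <;> omega
  · intro s _
    rw [weightVec, if_pos fun i => by simp only [φ]; split_ifs <;> simp]
    simp [φ]

/-- A subset of the positions, listed in order, and its complement cover all positions. -/
noncomputable def survivorsSumLost {n N : ℕ} (e : Fin n ↪o Fin N) :
    Fin n ⊕ {i // i ∉ Set.range e} ≃ Fin N :=
  open Classical in
  ((Equiv.ofInjective e e.injective).sumCongr (Equiv.refl _)).trans
    (Equiv.Set.sumCompl (Set.range e))

theorem survivorsSumLost_inl {n N : ℕ} (e : Fin n ↪o Fin N) (k : Fin n) :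
    survivorsSumLost e (Sum.inl k) = e k := rfl

theorem survivorsSumLost_inr {n N : ℕ} (e : Fin n ↪o Fin N) (i : {i // i ∉ Set.range e}) :
    survivorsSumLost e (Sum.inr i) = i := rfl

theorem deletion_apply {q n N : ℕ} (e : Fin n ↪o Fin N) (ρ : QuditOp q N) (x y : Fin n → Fin q) :
    deletion e ρ x y = ∑ a : {i // i ∉ Set.range e} → Fin q,
      ρ (Sum.elim x a ∘ (survivorsSumLost e).symm) (Sum.elim y a ∘ (survivorsSumLost e).symm) := by
  classical
  have hl : ∀ k, (survivorsSumLost e).symm (e k) = Sum.inl k := fun k => by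
    rw [Equiv.symm_apply_eq]; rw [survivorsSumLost_inl]
  have hr : ∀ i : {i // i ∉ Set.range e}, (survivorsSumLost e).symm i = Sum.inr i := fun i => by
    rw [Equiv.symm_apply_eq]; rw [survivorsSumLost_inr]
  have hglue : ∀ (z : Fin N → Fin q) (x : Fin n → Fin q), (∀ k, z (e k) = x k) →
      Sum.elim x (fun i : {i // i ∉ Set.range e} => z i) ∘ (survivorsSumLost e).symm = z := by
    intro z x h
    ext i : 1
    by_cases hi : i ∈ Set.range e
    · obtain ⟨k, rfl⟩ := hi
      simp [hl, h]
    · simp [hr ⟨i, hi⟩]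
  simp only [deletion, Matrix.of_apply]
  rw [← Fintype.sum_prod_type', ← Finset.sum_filter]
  refine Finset.sum_bij' (fun p _ i => p.1 i)
    (fun a _ => (Sum.elim x a ∘ (survivorsSumLost e).symm,
      Sum.elim y a ∘ (survivorsSumLost e).symm)) (by simp) ?_ ?_ ?_ ?_
  · intro a _
    simp only [Finset.mem_filter, Finset.mem_univ, true_and, Function.comp_apply, hl, Sum.elim_inl,
      implies_true]
    intro i hi
    rw [hr ⟨i, by simpa using hi⟩]
    rfl
  · rintro ⟨z, w⟩ h
    simp only [Finset.mem_filter, Finset.mem_univ, true_and] at h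
    obtain ⟨h1, h2, h3⟩ := h
    have : (fun i : {i // i ∉ Set.range e} => z i) = fun i : {i // i ∉ Set.range e} => w i := by
      ext i : 1
      exact h3 i (by simpa using i.2)
    refine Prod.ext (hglue z x h1) ?_
    rw [this]
    exact hglue w y h2
  · intro a _
    ext i : 1
    simp [hr i]
  · rintro ⟨z, w⟩ h
    simp only [Finset.mem_filter, Finset.mem_univ, true_and] at h
    obtain ⟨h1, h2, h3⟩ := h
    have : (fun i : {i // i ∉ Set.range e} => z i) = fun i : {i // i ∉ Set.range e} => w i := by
      ext i : 1
      exact h3 i (by simpa using i.2)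
    rw [hglue z x h1, this, hglue w y h2]

/-- The right side does not involve `e`, which is why one channel serves all deletion positions. -/
theorem deletion_pureState_weightVec {q n N : ℕ} (hq : 2 ≤ q) (e : Fin n ↪o Fin N) (f : ℕ → ℂ)
    (ψ : QuditSpace q N) (hψ : ∀ z, ψ z = weightVec f z) (x y : Fin n → Fin q) :
    deletion e (pureState ψ) x y = ∑ r ∈ Finset.range (N - n + 1), ((N - n).choose r : ℂ) *
      (weightVec (fun m => f (m + r)) x * star (weightVec (fun m => f (m + r)) y)) := by
  classical
  have hcard : Fintype.card {i // i ∉ Set.range e} = N - n := by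
    have := Fintype.card_congr (survivorsSumLost e)
    simp only [Fintype.card_sum, Fintype.card_fin] at this
    omega
  rw [deletion_apply]
  simp only [pureState, Matrix.of_apply, hψ, weightVec_comp_equiv, weightVec_sumElim,
    weightVec_mul_star]
  rw [sum_weightVec hq, hcard]

/-- Both sides sum over binary strings of length `n + s`, cut into two blocks on the left. It yields
total mass one after a deletion. -/
theorem sum_range_choose_add {s n : ℕ} (h : ℕ → ℂ) :
    ∑ r ∈ Finset.range (s + 1), (s.choose r : ℂ) *
      ∑ m ∈ Finset.range (n + 1), (n.choose m : ℂ) * h (m + r) =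
    ∑ w ∈ Finset.range (n + s + 1), ((n + s).choose w : ℂ) * h w := by
  have h1 : ∀ r, ∑ m ∈ Finset.range (n + 1), (n.choose m : ℂ) * h (m + r) =
      ∑ x : Fin n → Fin 2, weightVec (fun m => h (m + r)) x := fun r => by
    rw [sum_weightVec le_rfl, Fintype.card_fin]
  have h2 := sum_weightVec (q := 2) le_rfl (ι := Fin n ⊕ Fin s) h
  have h3 := sum_weightVec (q := 2) le_rfl (ι := Fin s)
    fun r => ∑ x : Fin n → Fin 2, weightVec (fun m => h (m + r)) x
  simp only [Fintype.card_sum, Fintype.card_fin] at h2 h3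
  simp only [h1]
  rw [← h2, ← h3, ← (Equiv.sumArrowEquivProdArrow (Fin n) (Fin s) (Fin 2)).symm.sum_comp,
    Fintype.sum_prod_type_right]
  refine Finset.sum_congr rfl fun a _ => ?_
  simp only [Equiv.sumArrowEquivProdArrow, Equiv.coe_fn_symm_mk, weightVec_sumElim]
  simp only [weightVec]
  split_ifs <;> simp

/-! ### Spaced weights and the polynomial form of the norms -/

/-- Weights `μ j w` on `{0, …, N}`, with supports for different `j` disjoint and contained in
the multiples of `t + 1`, which have the same moments up to order `t`. -/
theorem exists_spaced_weights (t m N : ℕ) (hN : (t + 1) ^ 2 * m ≤ N) :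
    ∃ μ : Fin (m + 1) → ℕ → ℝ, (∀ j w, 0 ≤ μ j w) ∧ (∀ j w, μ j w ≠ 0 → t + 1 ∣ w) ∧
      (∀ i j w, μ i w ≠ 0 → μ j w ≠ 0 → i = j) ∧
      (∀ j, ∑ w ∈ Finset.range (N + 1), μ j w = 1) ∧
      ∀ P : Polynomial ℝ, P.natDegree ≤ t → ∀ i j,
        ∑ w ∈ Finset.range (N + 1), μ i w * P.eval (w : ℝ) =
          ∑ w ∈ Finset.range (N + 1), μ j w * P.eval (w : ℝ) := by
  obtain ⟨c, l, hl0, hl1, hmom⟩ := exists_coloring_moments_eq t m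
  -- Each of the `m + 1` classes has mass `1 / (m + 1)`, by the moment of order zero; the factor `m
  -- + 1` normalises it.
  let μ : Fin (m + 1) → ℕ → ℝ := fun j w =>
    ∑ k : Fin ((t + 1) * m + 1), if (t + 1) * (k : ℕ) = w ∧ c k = j then (m + 1 : ℝ) * l k else 0
  have hex : ∀ j w, μ j w ≠ 0 → ∃ k : Fin ((t + 1) * m + 1), (t + 1) * (k : ℕ) = w ∧ c k = j := by
    intro j w h
    obtain ⟨k, -, hk⟩ := Finset.exists_ne_zero_of_sum_ne_zero h
    exact ⟨k, by by_contra hcon; exact hk (if_neg hcon)⟩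
  have hsum : ∀ (P : Polynomial ℝ) j, ∑ w ∈ Finset.range (N + 1), μ j w * P.eval (w : ℝ) =
      (m + 1) * ∑ k, if c k = j then
        l k * (P.comp (Polynomial.C ((t + 1 : ℕ) : ℝ) * Polynomial.X)).eval (k : ℝ) else 0 := by
    intro P j
    simp only [μ, Finset.sum_mul, Finset.mul_sum]
    rw [Finset.sum_comm]
    refine Finset.sum_congr rfl fun k _ => ?_
    rw [Finset.sum_eq_single ((t + 1) * (k : ℕ))]
    · by_cases h : c k = j
      · simp [h, mul_assoc]
      · simp [h]
    · intro w _ hw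
      rw [if_neg fun h => hw h.1.symm, zero_mul]
    · intro h
      have : (t + 1) * (k : ℕ) ≤ (t + 1) * ((t + 1) * m) :=
        Nat.mul_le_mul_left _ (Nat.lt_succ_iff.1 k.2)
      rw [← mul_assoc, ← sq] at this
      exact absurd (Finset.mem_range.2 (by omega)) h
  have hmom' : ∀ P : Polynomial ℝ, P.natDegree ≤ t → ∀ i j,
      ∑ w ∈ Finset.range (N + 1), μ i w * P.eval (w : ℝ) =
        ∑ w ∈ Finset.range (N + 1), μ j w * P.eval (w : ℝ) := by
    intro P hP i j
    rw [hsum, hsum, hmom _ _ i j]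
    refine Polynomial.natDegree_comp_le.trans ((Nat.mul_le_mul hP ?_).trans (mul_one t).le)
    exact (Polynomial.natDegree_C_mul_le _ _).trans Polynomial.natDegree_X_le
  refine ⟨μ, fun j w => Finset.sum_nonneg fun k _ => ?_, ?_, ?_, fun j => ?_, hmom'⟩
  · split_ifs
    · have := hl0 k
      positivity
    · exact le_rfl
  · intro j w h
    obtain ⟨k, rfl, -⟩ := hex j w h
    exact Dvd.intro _ rfl
  · intro i j w hi hj
    obtain ⟨k, hk, rfl⟩ := hex i w hi
    obtain ⟨k', hk', rfl⟩ := hex j w hj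
    rw [Fin.ext (Nat.eq_of_mul_eq_mul_left t.succ_pos (hk.trans hk'.symm))]
  · have h1 : ∀ i, ∑ w ∈ Finset.range (N + 1), μ i w = ∑ w ∈ Finset.range (N + 1), μ j w :=
      fun i => by simpa using hmom' 1 (by simp) i j
    have h2 : ∑ i, ∑ w ∈ Finset.range (N + 1), μ i w = m + 1 := by
      have : ∀ i, ∑ w ∈ Finset.range (N + 1), μ i w = (m + 1) * ∑ k, if c k = i then l k else 0 :=
        fun i => by simpa using hsum 1 i
      simp only [this]
      rw [← Finset.mul_sum, Finset.sum_comm]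
      simp [hl1]
    simp only [h1, Finset.sum_const, Finset.card_univ, Fintype.card_fin, nsmul_eq_mul] at h2
    push_cast at h2
    have : (m + 1 : ℝ) ≠ 0 := by positivity
    exact mul_left_cancel₀ this (by rw [h2, mul_one])

/-- With `n = a + b`, `N = n + r + u` and `w = a + r`, this expresses `n.choose a / N.choose w`
through falling factorials of `w` and `N - w`, hence as a polynomial in `w` of degree `r + u`. -/
theorem choose_mul_descFactorial_add (a b r u : ℕ) :
    (a + b).choose a * (a + b + (r + u)).descFactorial (r + u) =
      (a + b + (r + u)).choose (a + r) * ((a + r).descFactorial r * (b + u).descFactorial u) := by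
  have h1 := Nat.factorial_mul_descFactorial (n := a + b + (r + u)) (k := r + u) (by omega)
  have h2 := Nat.factorial_mul_descFactorial (n := a + r) (k := r) (by omega)
  have h3 := Nat.factorial_mul_descFactorial (n := b + u) (k := u) (by omega)
  have h4 := Nat.choose_mul_factorial_mul_factorial (n := a + b) (k := a) (by omega)
  have h5 := Nat.choose_mul_factorial_mul_factorial (n := a + b + (r + u)) (k := a + r) (by omega)
  simp only [Nat.add_sub_cancel, Nat.add_sub_cancel_left] at h1 h2 h3 h4
  rw [show a + b + (r + u) - (a + r) = b + u by omega] at h5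
  have hpos : 0 < a.factorial * b.factorial := by positivity
  refine Nat.eq_of_mul_eq_mul_left hpos ?_
  calc a.factorial * b.factorial *
        ((a + b).choose a * (a + b + (r + u)).descFactorial (r + u))
      = ((a + b).choose a * a.factorial * b.factorial) *
        (a + b + (r + u)).descFactorial (r + u) := by ring
    _ = (a + b + (r + u)).choose (a + r) * (a.factorial * (a + r).descFactorial r) *
        (b.factorial * (b + u).descFactorial u) := by rw [h4, h1, h2, h3, h5]
    _ = _ := by ring

/-- Up to the binomial coefficient, the fraction of strings of weight `w` and length `n + s`
whose restriction to given `s` positions is a given string of weight `r`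
is a polynomial in `w` of degree `s`. -/
theorem exists_polynomial_sum_choose_div (n s r : ℕ) (hr : r ≤ s) :
    ∃ P : Polynomial ℝ, P.natDegree ≤ s ∧ ∀ μ : ℕ → ℝ,
      ∑ a ∈ Finset.range (n + 1), (n.choose a : ℝ) * (μ (a + r) / (n + s).choose (a + r)) =
        ∑ w ∈ Finset.range (n + s + 1), μ w * P.eval (w : ℝ) := by
  obtain ⟨u, rfl⟩ := Nat.exists_eq_add_of_le hr
  set N := n + (r + u) with hNdef
  have hD : ((N.descFactorial (r + u) : ℕ) : ℝ) ≠ 0 := by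
    have : 0 < N.descFactorial (r + u) := Nat.descFactorial_pos.2 (by omega)
    positivity
  let P : Polynomial ℝ := Polynomial.C ((N.descFactorial (r + u) : ℝ)⁻¹) *
    (descPochhammer ℝ r * (descPochhammer ℝ u).comp (Polynomial.C (N : ℝ) - Polynomial.X))
  have hev : ∀ w ≤ N, P.eval (w : ℝ) =
      (N.descFactorial (r + u) : ℝ)⁻¹ * (w.descFactorial r * (N - w).descFactorial u) := by
    intro w hw
    simp only [P, Polynomial.eval_mul, Polynomial.eval_C, Polynomial.eval_comp,
      Polynomial.eval_sub, Polynomial.eval_X, ← Nat.cast_sub hw,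
      descPochhammer_eval_eq_descFactorial]
  refine ⟨P, ?_, fun μ => ?_⟩
  · refine (Polynomial.natDegree_C_mul_le _ _).trans (Polynomial.natDegree_mul_le.trans ?_)
    rw [descPochhammer_natDegree]
    refine Nat.add_le_add_left (Polynomial.natDegree_comp_le.trans ?_) _
    rw [descPochhammer_natDegree]
    refine (Nat.mul_le_mul_left u ?_).trans (mul_one u).le
    exact (Polynomial.natDegree_sub_le _ _).trans (by simp)
  · refine Finset.sum_of_injOn (· + r) (fun _ _ _ _ h => Nat.add_right_cancel h) ?_ ?_ ?_
    · intro a ha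
      simp only [Finset.coe_range, Set.mem_Iio] at ha ⊢
      omega
    -- Weights not of the form `a + r` with `a ≤ n` have `w < r` or `N - w < u`, and there a falling
    -- factorial vanishes.
    · intro w hw hw'
      have hwN : w ≤ N := Nat.lt_succ_iff.1 (Finset.mem_range.1 hw)
      rw [hev w hwN]
      by_cases h1 : w < r
      · simp [Nat.descFactorial_of_lt h1]
      · have h2 : N - w < u := by
          by_contra h2
          exact hw' ⟨w - r, by simp only [Finset.coe_range, Set.mem_Iio]; omega,
            by dsimp only; omega⟩
        simp [Nat.descFactorial_of_lt h2]
    · intro a ha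
      have ha' : a ≤ n := Nat.lt_succ_iff.1 (Finset.mem_range.1 ha)
      obtain ⟨b, rfl⟩ := Nat.exists_eq_add_of_le ha'
      rw [hev _ (by omega), show N - (a + r) = b + u by omega]
      have hC : ((N.choose (a + r) : ℕ) : ℝ) ≠ 0 := by
        have : 0 < N.choose (a + r) := Nat.choose_pos (by omega)
        positivity
      have key := choose_mul_descFactorial_add a b r u
      rw [← hNdef] at key
      have key' : ((a + b).choose a : ℝ) * N.descFactorial (r + u) =
          N.choose (a + r) * ((a + r).descFactorial r * (b + u).descFactorial u) := by
        exact_mod_cast key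
      field_simp
      linear_combination μ (a + r) * key'

/-! ### The code and its error correction -/

theorem weightVec_sum_mul {q : ℕ} {ι J : Type*} [Fintype ι] [Fintype J] (f : J → ℕ → ℂ)
    (β : J → ℂ) (z : ι → Fin q) :
    weightVec (fun m => ∑ j, f j m * β j) z = ∑ j, weightVec (f j) z * β j := by
  simp only [weightVec]
  split_ifs <;> simp

open scoped Matrix in
theorem mul_vecMulVec_star_mul_conjTranspose {X J : Type*} [Fintype X] [Fintype J]
    (A : Matrix X J ℂ) (β : J → ℂ) :
    A * Matrix.vecMulVec β (star β) * Aᴴ = Matrix.vecMulVec (A *ᵥ β) (star (A *ᵥ β)) := by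
  rw [Matrix.mul_vecMulVec, Matrix.vecMulVec_mul, Matrix.star_mulVec]

open scoped Matrix in
theorem theorem1 (q t M N : ℕ) (hq : 2 ≤ q) (hM : 1 ≤ M) (hN : (t + 1) ^ 2 * (M - 1) ≤ N) :
    ∃ C : Submodule ℂ (QuditSpace q N),
      Module.finrank ℂ C = M ∧ IsPermutationInvariant C ∧ CorrectsDeletions t C := by
  obtain ⟨m, rfl⟩ : ∃ m, M = m + 1 := ⟨M - 1, by omega⟩
  obtain ⟨μ, hμ0, hμdvd, hμdisj, hμ1, hμmom⟩ := exists_spaced_weights t m N hN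
  let f : Fin (m + 1) → ℕ → ℝ := fun j w => Real.sqrt (μ j w / N.choose w)
  have hff : ∀ j w, f j w * f j w = μ j w / N.choose w := fun j w =>
    Real.mul_self_sqrt (div_nonneg (hμ0 j w) (Nat.cast_nonneg _))
  have hf : ∀ j w, f j w ≠ 0 → μ j w ≠ 0 := fun j w h h0 => h (by simp [f, h0])
  -- Column `j` is codeword `j` seen by `n` survivors when the lost letters contain `r` ones; `A N
  -- 0` is the encoder.
  let A : ∀ (n r : ℕ), Matrix (Fin n → Fin q) (Fin (m + 1)) ℂ := fun n r =>
    Matrix.of fun x j => weightVec (fun a => (f j (a + r) : ℂ)) x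
  let γ : ℕ → ℕ → ℝ := fun n r =>
    ∑ a ∈ Finset.range (n + 1), (n.choose a : ℝ) * (f 0 (a + r) * f 0 (a + r))
  have hA : ∀ n s, n + s = N → s ≤ t → ∀ r ≤ s, ∀ r' ≤ s, (A n r)ᴴ * A n r' =
      if r = r' then (γ n r : ℂ) • 1 else 0 := by
    intro n s hns hst r hr r' hr'
    have hent : ∀ i j, ((A n r)ᴴ * A n r') i j = ((∑ a ∈ Finset.range (n + 1),
        (n.choose a : ℝ) * (f i (a + r) * f j (a + r')) : ℝ) : ℂ) := by
      intro i j
      simp only [Matrix.mul_apply, Matrix.conjTranspose_apply, A, Matrix.of_apply,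
        star_weightVec_mul]
      rw [sum_weightVec hq]
      simp
    ext i j
    rw [hent]
    split_ifs with hrr
    · subst hrr
      rw [Matrix.smul_apply, Matrix.one_apply, smul_eq_mul]
      split_ifs with hij
      · subst hij
        obtain ⟨P, hP, hPs⟩ := exists_polynomial_sum_choose_div n s r hr
        simp only [γ, hff, mul_one, ← hns, hPs]
        rw [hns, hμmom P (hP.trans hst) i 0]
      · rw [mul_zero, Complex.ofReal_eq_zero]
        refine Finset.sum_eq_zero fun a _ => ?_
        by_contra hcon
        have h := (mul_ne_zero_iff.1 (mul_ne_zero_iff.1 hcon).2)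
        exact hij (hμdisj _ _ _ (hf _ _ h.1) (hf _ _ h.2))
    · rw [Matrix.zero_apply, Complex.ofReal_eq_zero]
      refine Finset.sum_eq_zero fun a _ => ?_
      by_contra hcon
      have h := (mul_ne_zero_iff.1 (mul_ne_zero_iff.1 hcon).2)
      have h1 := hμdvd _ _ (hf _ _ h.1)
      have h2 := hμdvd _ _ (hf _ _ h.2)
      -- Two multiples of `t + 1` cannot differ by `|r - r'|`, which lies between `1` and `t`.
      rcases lt_or_gt_of_ne hrr with hlt | hlt
      · have := Nat.le_of_dvd (by omega) (Nat.dvd_sub h2 h1)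
        omega
      · have := Nat.le_of_dvd (by omega) (Nat.dvd_sub h1 h2)
        omega
  have hnorm : ∑ w ∈ Finset.range (N + 1), (N.choose w : ℝ) * (f 0 w * f 0 w) = 1 := by
    rw [← hμ1 0]
    refine Finset.sum_congr rfl fun w hw => ?_
    have : 0 < N.choose w := Nat.choose_pos (Nat.lt_succ_iff.1 (Finset.mem_range.1 hw))
    rw [hff, mul_div_cancel₀]
    positivity
  have hB : (A N 0)ᴴ * A N 0 = 1 := by
    rw [hA N 0 rfl (Nat.zero_le _) 0 le_rfl 0 le_rfl, if_pos rfl]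
    simp only [γ, add_zero, hnorm, Complex.ofReal_one, one_smul]
  let c : Fin (m + 1) → QuditSpace q N := fun j => WithLp.toLp 2 fun z => A N 0 z j
  have hc : Orthonormal ℂ c := by
    rw [orthonormal_iff_ite]
    intro i j
    rw [← Matrix.one_apply, ← hB, Matrix.mul_apply, PiLp.inner_apply]
    refine Finset.sum_congr rfl fun z _ => ?_
    simp [c, mul_comm]
  have hmem : ∀ ψ ∈ Submodule.span ℂ (Set.range c), ∃ β : Fin (m + 1) → ℂ,
      ∀ z, ψ z = (A N 0 *ᵥ β) z := by
    intro ψ hψ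
    obtain ⟨β, rfl⟩ := (Submodule.mem_span_range_iff_exists_fun ℂ).1 hψ
    exact ⟨β, fun z => by simp [c, Matrix.mulVec, dotProduct, mul_comm]⟩
  have hAβ : ∀ n r β x, (A n r *ᵥ β) x = weightVec (fun a => ∑ j, (f j (a + r) : ℂ) * β j) x := by
    intro n r β x
    rw [weightVec_sum_mul]
    rfl
  refine ⟨Submodule.span ℂ (Set.range c), ?_, ?_, ?_⟩
  · rw [finrank_span_eq_card hc.linearIndependent, Fintype.card_fin]
  · intro ψ hψ σ x
    obtain ⟨β, hβ⟩ := hmem ψ hψ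
    rw [hβ, hβ, hAβ, hAβ, weightVec_comp_equiv]
  · intro n hn hnt
    obtain ⟨s, hs⟩ := Nat.exists_eq_add_of_le hn
    obtain ⟨R, hR, hRec⟩ := exists_recovery_channel (n := n) (ι := Fin (s + 1))
      (fun _ => (⟨0, by omega⟩ : Fin q)) (A N 0) hB (fun r => A n r) (fun r => γ n r)
      (fun r => Finset.sum_nonneg fun a _ => mul_nonneg (Nat.cast_nonneg _) (mul_self_nonneg _))
      (fun r r' => by
        rw [hA n s hs.symm (by omega) r (Nat.lt_succ_iff.1 r.2) r' (Nat.lt_succ_iff.1 r'.2)]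
        simp only [Fin.ext_iff])
    refine ⟨R, hR, fun e ψ hψ => ?_⟩
    obtain ⟨β, hβ⟩ := hmem ψ hψ
    have hdel : deletion e (pureState ψ) = ∑ r : Fin (s + 1), (s.choose r : ℂ) •
        (A n r * Matrix.vecMulVec β (star β) * (A n r)ᴴ) := by
      ext x y
      rw [deletion_pureState_weightVec hq e (fun a => ∑ j, (f j (a + 0) : ℂ) * β j) ψ
        (fun z => by rw [hβ, hAβ]), show N - n = s by omega,
        ← Fin.sum_univ_eq_sum_range (fun r => (s.choose r : ℂ) * _), Matrix.sum_apply]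
      refine Finset.sum_congr rfl fun r _ => ?_
      rw [Matrix.smul_apply, mul_vecMulVec_star_mul_conjTranspose, Matrix.vecMulVec_apply,
        Pi.star_apply, hAβ, hAβ]
      rfl
    -- The outcome probabilities sum to one, so recovery returns the state with no scalar factor.
    have htot : ∑ r : Fin (s + 1), (s.choose r : ℂ) * (γ n r : ℂ) = 1 := by
      have h := sum_range_choose_add (s := s) (n := n) fun w => ((f 0 w * f 0 w : ℝ) : ℂ)
      rw [← hs] at h
      rw [Fin.sum_univ_eq_sum_range (fun r => (s.choose r : ℂ) * (γ n r : ℂ))]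
      have hnorm' := congrArg (fun x : ℝ => (x : ℂ)) hnorm
      push_cast at hnorm' h
      rw [← hnorm', ← h]
      simp [γ]
    rw [hdel, hRec, htot, one_smul, mul_vecMulVec_star_mul_conjTranspose]
    ext x y
    simp [pureState, Matrix.vecMulVec_apply, hβ]
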